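/- Let $S$ be a (not necessarily cancellative) monoid which is left Ore (for all $s,t\in S$ there are $s',t'\in S$ with $s't=t's$) and left reversible (if $ts=us$ in $S$, then $s't=s'u$ for some $s'\in S$). Let $G=S^{-1}S$ be its enveloping group (the Ore localization of $S$ at itself, which is a group), let $\lambda\colon S\to G$ be the natural map and let $\widetilde S=\lambda(S)$, a submonoid of $G$. Let $A$ be a unital ring and let $\alpha\colon S\to\mathrm{Endr}(A)$, $s\mapsto\alpha_s$, be a monoid homomorphism into the monoid of not necessarily unital ring endomorphisms of $A$. Put $I=\bigcup_{s\in S}\ker(\alpha_s)$, a two-sided ideal of $A$, and assume $I\neq A$ (equivalently, $\alpha_s\ne 0$ for all $s\in S$). The action $\alpha$ induces an action $\alpha'$ of $S$ on $A/I$, and $\alpha'$ factors through an action of $\widetilde S$ on $A/I$, again written $\alpha'$. Notation. For an action $\beta$ of a left Ore, left reversible monoid $M$ on a unital ring $B$ by not necessarily unital endomorphisms, $M^{\mathrm{op}}*_\beta B*_\beta M$ is the unital ring that is universal with respect to a unital ring homomorphism $\phi$ from $B$, a monoid homomorphism $s\mapsto s_-$ from $M^{\mathrm{op}}$ and a monoid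 homomorphism $s\mapsto s_+$ from $M$ such that $s_+\phi(b)=\phi(\beta_s(b))s_+$, $\phi(b)s_-=s_-\phi(\beta_s(b))$, $s_-s_+=1$ and $s_+s_-=\phi(\beta_s(1))$. Its subset $M_-BM_+=\{s_-\phi(b)s_+ : s\in M,\ b\in B\}$ is a unital subring, on which $M$ acts by $\overline\beta_s(x)=s_+xs_-$. For an action $\gamma$ of $M$ on a ring $C$, $M^{-1}C$ is the not necessarily unital ring of classes $[s,c]$ of pairs in $M\times C$, where $[s_1,c_1]=[s_2,c_2]$ if and only if $t_1s_1=t_2s_2$ and $\gamma_{t_1}(c_1)=\gamma_{t_2}(c_2)$ for some $t_1,t_2\in M$, with $[s_1,c_1]+[s_2,c_2]=[t_1s_1,\gamma_{t_1}(c_1)+\gamma_{t_2}(c_2)]$ and $[s_1,c_1][s_2,c_2]=[t_1s_1,\gamma_{t_1}(c_1)\gamma_{t_2}(c_2)]$ whenever $t_1s_1=t_2s_2$. For an action $\delta\colon G\to\mathrm{Aut}(D)$ on a not necessarily unital ring $D$, $D*_\delta G$ is the skew group ring of finite sums $\sum d_gg$ with $(dg)(d'h)=d\,\delta_g(d')\,gh$.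 Let $D=\widetilde S^{-1}(\widetilde S_-(A/I)\widetilde S_+)$, formed with respect to $\alpha'$ and $\overline{\alpha'}$, and let $\iota\colon A/I\to D$, $\iota(a)=[1,\phi(a)]$. Then $\iota$ is an injective ring homomorphism, and $\alpha$ extends to an action $\widehat\alpha\colon G\to\mathrm{Aut}(D)$: writing $\widehat\alpha_s=\widehat\alpha_{\lambda(s)}$ for $s\in S$, one has $\widehat\alpha_s(\iota(a))=\iota(\alpha'_s(a))$ for all $a\in A/I$, and $\widehat\alpha_s([x,b])=[s',\overline{\alpha'}_{x'}(b)]$ whenever $x,x',s'\in\widetilde S$ satisfy $s'\lambda(s)=x'x$ and $b\in\widetilde S_-(A/I)\widetilde S_+$. Moreover there is a nonzero idempotent $e\in D$ with $\widehat\alpha_s(e)\le e$ (that is, $\widehat\alpha_s(e)=\widehat\alpha_s(e)e=e\widehat\alpha_s(e)$) for all $s\in S$, and there is a surjective unital ring homomorphism $$\Phi\colon S^{\mathrm{op}}*_\alpha A*_\alpha S\twoheadrightarrow e\,(D*_{\widehat\alpha}G)\,e$$ which is $S$-equivariant: $\Phi(s_+rs_-)=(\lambda(s)e)\,\Phi(r)\,(e\lambda(s)^{-1})$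 for all $s\in S$ and $r\in S^{\mathrm{op}}*_\alpha A*_\alpha S$, and, more precisely, $\Phi(\phi(a))=\iota(a+I)$ for $a\in A$, $\Phi(s_+)=\lambda(s)e$ and $\Phi(s_-)=e\lambda(s)^{-1}$ for $s\in S$. Here $\lambda(s)e$ and $e\lambda(s)^{-1}$ denote the elements $\widehat\alpha_s(e)\lambda(s)$ and $e\,\lambda(s)^{-1}$ of $D*_{\widehat\alpha}G$. -/

import Mathlib

/-! ### Left denominator monoids and their enveloping groups -/

/-- A left Ore, left reversible (not necessarily cancellative) monoid. -/
class LeftDenominatorMonoid (S : Type*) [Monoid S] : Prop where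
  /-- The left Ore condition. -/
  ore : ∀ s t : S, ∃ s' t' : S, s' * t = t' * s
  /-- Left reversibility. -/
  reversible : ∀ t u s : S, t * s = u * s → ∃ s' : S, s' * t = s' * u

noncomputable section

namespace EnvelopingGroup

/-- The whole monoid is a left Ore set in itself. -/
@[reducible]
def oreSet (S : Type*) [Monoid S] [LeftDenominatorMonoid S] :
    OreLocalization.OreSet (⊤ : Submonoid S) where
  ore_right_cancel t u s h := by
    obtain ⟨s', hs'⟩ := LeftDenominatorMonoid.reversible t u (s : S) h
    exact ⟨⟨s', trivial⟩, hs'⟩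
  oreNum r s := (LeftDenominatorMonoid.ore (s : S) r).choose_spec.choose
  oreDenom r s := ⟨(LeftDenominatorMonoid.ore (s : S) r).choose, trivial⟩
  ore_eq r s := (LeftDenominatorMonoid.ore (s : S) r).choose_spec.choose_spec

end EnvelopingGroup

/-- The enveloping group `G = S⁻¹S`: the Ore localization of `S` at all of its elements. -/
def EnvelopingGroup (S : Type*) [Monoid S] [LeftDenominatorMonoid S] : Type _ :=
  letI := EnvelopingGroup.oreSet S
  OreLocalization (⊤ : Submonoid S) S

namespace EnvelopingGroup

variable (S : Type*) [Monoid S] [LeftDenominatorMonoid S]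

instance instMonoid : Monoid (EnvelopingGroup S) :=
  letI := EnvelopingGroup.oreSet S
  inferInstanceAs (Monoid (OreLocalization (⊤ : Submonoid S) S))

instance instGroup : Group (EnvelopingGroup S) :=
  groupOfIsUnit fun x => by
    let _ := EnvelopingGroup.oreSet S
    induction x using OreLocalization.ind with
    | _ r s =>
      exact ⟨⟨OreLocalization.oreDiv r s,
        OreLocalization.oreDiv (s : S) (⟨r, trivial⟩ : (⊤ : Submonoid S)),
        OreLocalization.mul_inv (⟨r, trivial⟩ : (⊤ : Submonoid S)) s,
        OreLocalization.mul_inv s (⟨r, trivial⟩ : (⊤ : Submonoid S))⟩, rfl⟩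

/-- The natural map `λ : S → G`. -/
def of : S →* EnvelopingGroup S :=
  letI := EnvelopingGroup.oreSet S
  (OreLocalization.numeratorHom : S →* OreLocalization (⊤ : Submonoid S) S)

variable {S} in
theorem of_eq_of {s t : S} (h : of S s = of S t) : ∃ u : S, u * s = u * t := by
  let _ := EnvelopingGroup.oreSet S
  have h' : OreLocalization.oreDiv s (1 : (⊤ : Submonoid S)) =
      OreLocalization.oreDiv t (1 : (⊤ : Submonoid S)) := h
  rw [OreLocalization.oreDiv_eq_iff] at h'
  obtain ⟨u, v, h1, h2⟩ := h'
  have h3 : (u : S) = v := by simpa using h2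
  refine ⟨v, ?_⟩
  rw [← h3]
  rw [← h3] at h1
  exact h1.symm

/-- `S̃ = λ(S)`, a submonoid of `G`. -/
def tilde : Submonoid (EnvelopingGroup S) := MonoidHom.mrange (of S)

/-- The map `λ`, viewed as a map from `S` onto `S̃`. -/
def toTilde : S →* tilde S := (of S).mrangeRestrict

theorem toTilde_surjective : Function.Surjective (toTilde S) :=
  (of S).mrangeRestrict_surjective

instance : LeftDenominatorMonoid (tilde S) where
  ore x y := by
    obtain ⟨s, rfl⟩ := toTilde_surjective S x
    obtain ⟨t, rfl⟩ := toTilde_surjective S y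
    obtain ⟨s', t', h⟩ := LeftDenominatorMonoid.ore s t
    exact ⟨toTilde S s', toTilde S t', by rw [← map_mul, ← map_mul, h]⟩
  reversible t u s h := ⟨1, by rw [mul_right_cancel h]⟩

end EnvelopingGroup

/-! ### The kernel ideal and the induced actions on `A/I` -/

namespace MonoidAction

variable {S A : Type*} [Monoid S] [LeftDenominatorMonoid S] [Ring A] (α : S →* (A →ₙ+* A))

/-- The ideal `I = ⋃ ker α_s` of `A`. -/
def kernelIdeal : Ideal A where
  carrier := {a | ∃ s : S, α s a = 0}
  zero_mem' := ⟨1, map_zero _⟩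
  add_mem' := by
    rintro a b ⟨s, hs⟩ ⟨t, ht⟩
    obtain ⟨s', t', h⟩ := LeftDenominatorMonoid.ore s t
    refine ⟨s' * t, ?_⟩
    have h1 : α (s' * t) a = 0 := by
      rw [h, map_mul]; change α t' (α s a) = 0; rw [hs, map_zero]
    have h2 : α (s' * t) b = 0 := by
      rw [map_mul]; change α s' (α t b) = 0; rw [ht, map_zero]
    rw [map_add, h1, h2, add_zero]
  smul_mem' := by
    rintro c a ⟨s, hs⟩
    exact ⟨s, by rw [smul_eq_mul, map_mul, hs, mul_zero]⟩

instance : (kernelIdeal α).IsTwoSided where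
  mul_mem_of_left := by
    rintro a b ⟨s, hs⟩
    exact ⟨s, by rw [map_mul, hs, zero_mul]⟩

theorem map_mem_kernelIdeal (s : S) {a : A} (ha : a ∈ kernelIdeal α) :
    α s a ∈ kernelIdeal α := by
  obtain ⟨t, ht⟩ := ha
  obtain ⟨s', t', h⟩ := LeftDenominatorMonoid.ore t s
  refine ⟨s', ?_⟩
  change (α s' * α s) a = 0
  rw [← map_mul, h, map_mul]
  change α t' (α t a) = 0
  rw [ht, map_zero]

/-- The endomorphism of `A/I` induced by `α_s`. -/
def quotientMap (s : S) : A ⧸ kernelIdeal α →ₙ+* A ⧸ kernelIdeal α where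
  toFun := Quotient.map' (α s) fun a b h => by
    rw [Submodule.quotientRel_def] at h ⊢
    rw [← map_sub]
    exact map_mem_kernelIdeal α s h
  map_mul' := by
    rintro ⟨a⟩ ⟨b⟩
    exact congrArg (Ideal.Quotient.mk (kernelIdeal α)) (map_mul (α s) a b)
  map_zero' := congrArg (Ideal.Quotient.mk (kernelIdeal α)) (map_zero (α s))
  map_add' := by
    rintro ⟨a⟩ ⟨b⟩
    exact congrArg (Ideal.Quotient.mk (kernelIdeal α)) (map_add (α s) a b)

theorem quotientMap_mk (s : S) (a : A) :
    quotientMap α s (Ideal.Quotient.mk _ a) = Ideal.Quotient.mk _ (α s a) := rfl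

/-- The action `α'` of `S` on `A/I` induced by `α`. -/
def quotientAction : S →* (A ⧸ kernelIdeal α →ₙ+* A ⧸ kernelIdeal α) where
  toFun := quotientMap α
  map_one' := by
    ext x
    obtain ⟨a, rfl⟩ := Ideal.Quotient.mk_surjective x
    rw [quotientMap_mk, map_one]; rfl
  map_mul' s t := by
    ext x
    obtain ⟨a, rfl⟩ := Ideal.Quotient.mk_surjective x
    rw [quotientMap_mk, map_mul]; rfl

theorem quotientAction_injective (s : S) : Function.Injective (quotientAction α s) := by
  rw [injective_iff_map_eq_zero]
  intro x hx
  obtain ⟨a, rfl⟩ := Ideal.Quotient.mk_surjective x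
  rw [Ideal.Quotient.eq_zero_iff_mem]
  have hx' : Ideal.Quotient.mk (kernelIdeal α) (α s a) = 0 := hx
  rw [Ideal.Quotient.eq_zero_iff_mem] at hx'
  obtain ⟨t, ht⟩ := hx'
  exact ⟨t * s, by rw [map_mul]; exact ht⟩

theorem quotientAction_eq_of_tilde_eq {s t : S}
    (h : EnvelopingGroup.toTilde S s = EnvelopingGroup.toTilde S t) :
    quotientAction α s = quotientAction α t := by
  obtain ⟨u, hu⟩ := EnvelopingGroup.of_eq_of (congrArg Subtype.val h)
  ext x
  apply quotientAction_injective α u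
  change (quotientAction α u * quotientAction α s) x = (quotientAction α u * quotientAction α t) x
  rw [← map_mul, ← map_mul, hu]

/-- The action of `S̃ = λ(S)` on `A/I` through which the action `α'` of `S` factors. -/
def tildeAction : EnvelopingGroup.tilde S →* (A ⧸ kernelIdeal α →ₙ+* A ⧸ kernelIdeal α) where
  toFun x := quotientAction α (EnvelopingGroup.toTilde_surjective S x).choose
  map_one' := by
    rw [← map_one (quotientAction α)]
    apply quotientAction_eq_of_tilde_eq
    rw [(EnvelopingGroup.toTilde_surjective S 1).choose_spec, map_one]
  map_mul' x y := by
    rw [← map_mul (quotientAction α)]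
    apply quotientAction_eq_of_tilde_eq
    rw [map_mul, (EnvelopingGroup.toTilde_surjective S (x * y)).choose_spec,
      (EnvelopingGroup.toTilde_surjective S x).choose_spec,
      (EnvelopingGroup.toTilde_surjective S y).choose_spec]

theorem tildeAction_toTilde (s : S) (a : A) :
    tildeAction α (EnvelopingGroup.toTilde S s) (Ideal.Quotient.mk _ a) =
      Ideal.Quotient.mk _ (α s a) := by
  rw [← quotientMap_mk]
  exact DFunLike.congr_fun (quotientAction_eq_of_tilde_eq α
    (EnvelopingGroup.toTilde_surjective S (EnvelopingGroup.toTilde S s)).choose_spec) _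

end MonoidAction

/-! ### Fractional skew monoid rings -/

namespace FractionalSkewMonoidRing

/-- The generators `φ(a)`, `s₋` and `s₊` of the fractional skew monoid ring. -/
inductive Generator (M A : Type*)
  | coeff (a : A) : Generator M A
  | minus (s : M) : Generator M A
  | plus (s : M) : Generator M A

variable {M A : Type*} [Monoid M] [Ring A]

local notation "c(" a ")" => FreeAlgebra.ι ℤ (Generator.coeff a)
local notation "m(" s ")" => FreeAlgebra.ι ℤ (Generator.minus s)
local notation "p(" s ")" => FreeAlgebra.ι ℤ (Generator.plus s)

/-- The relations of the fractional skew monoid ring: `φ` is a unital ring homomorphism,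
`s ↦ s₋` is a monoid homomorphism from the opposite monoid, `s ↦ s₊` is a monoid homomorphism,
and the four relations that link them hold. -/
inductive Rel (α : M →* (A →ₙ+* A)) :
    FreeAlgebra ℤ (Generator M A) → FreeAlgebra ℤ (Generator M A) → Prop
  | coeff_add (a b : A) : Rel α c(a + b) (c(a) + c(b))
  | coeff_mul (a b : A) : Rel α c(a * b) (c(a) * c(b))
  | coeff_one : Rel α c((1 : A)) 1
  | minus_one : Rel α m((1 : M)) 1
  | minus_mul (s t : M) : Rel α m(s * t) (m(t) * m(s))
  | plus_one : Rel α p((1 : M)) 1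
  | plus_mul (s t : M) : Rel α p(s * t) (p(s) * p(t))
  | plus_coeff (t : M) (a : A) : Rel α (p(t) * c(a)) (c(α t a) * p(t))
  | coeff_minus (s : M) (a : A) : Rel α (c(a) * m(s)) (m(s) * c(α s a))
  | minus_plus (s : M) : Rel α (m(s) * p(s)) 1
  | plus_minus (s : M) : Rel α (p(s) * m(s)) c(α s 1)

end FractionalSkewMonoidRing

open FractionalSkewMonoidRing in
/-- The fractional skew monoid ring `Mᵒᵖ *_α A *_α M`: the unital ring with generators `φ(a)`, `s₋`,
`s₊` that is universal for the relations above. -/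
def FractionalSkewMonoidRing {M A : Type*} [Monoid M] [Ring A] (α : M →* (A →ₙ+* A)) : Type _ :=
  RingQuot (Rel α)

namespace FractionalSkewMonoidRing

variable {M A : Type*} [Monoid M] [Ring A] (α : M →* (A →ₙ+* A))

instance : Ring (FractionalSkewMonoidRing α) :=
  inferInstanceAs (Ring (RingQuot (Rel α)))

/-- The canonical projection from the free ring on the generators. -/
def proj : FreeAlgebra ℤ (Generator M A) →+* FractionalSkewMonoidRing α :=
  RingQuot.mkRingHom (Rel α)

theorem proj_rel {x y : FreeAlgebra ℤ (Generator M A)} (h : Rel α x y) : proj α x = proj α y :=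
  RingQuot.mkRingHom_rel h

/-- The unital ring homomorphism `φ : A → Mᵒᵖ *_α A *_α M`. -/
def coeff : A →+* FractionalSkewMonoidRing α where
  toFun a := proj α (FreeAlgebra.ι ℤ (Generator.coeff a))
  map_one' := by rw [proj_rel α Rel.coeff_one, map_one]
  map_mul' a b := by rw [proj_rel α (Rel.coeff_mul a b), map_mul]
  map_zero' := by
    have h := proj_rel α (Rel.coeff_add 0 0)
    rw [add_zero, map_add] at h
    exact left_eq_add.mp h
  map_add' a b := by rw [proj_rel α (Rel.coeff_add a b), map_add]

/-- The element `s₋`. -/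
def minus (s : M) : FractionalSkewMonoidRing α :=
  proj α (FreeAlgebra.ι ℤ (Generator.minus s))

/-- The monoid homomorphism `s ↦ s₊`. -/
def plus : M →* FractionalSkewMonoidRing α where
  toFun s := proj α (FreeAlgebra.ι ℤ (Generator.plus s))
  map_one' := by rw [proj_rel α Rel.plus_one, map_one]
  map_mul' s t := by rw [proj_rel α (Rel.plus_mul s t), map_mul]

theorem minus_one : minus α (1 : M) = 1 := by
  rw [minus, proj_rel α Rel.minus_one, map_one]

theorem minus_mul (s t : M) : minus α (s * t) = minus α t * minus α s := by
  rw [minus, proj_rel α (Rel.minus_mul s t), map_mul]; rfl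

theorem plus_coeff (t : M) (a : A) : plus α t * coeff α a = coeff α (α t a) * plus α t := by
  have h := proj_rel α (Rel.plus_coeff t a)
  rwa [map_mul, map_mul] at h

theorem minus_plus (s : M) : minus α s * plus α s = 1 := by
  have h := proj_rel α (Rel.minus_plus s)
  rwa [map_mul, map_one] at h

theorem plus_minus (s : M) : plus α s * minus α s = coeff α (α s 1) := by
  have h := proj_rel α (Rel.plus_minus s)
  rwa [map_mul] at h

theorem plus_coeff_minus (s : M) (a : A) :
    plus α s * coeff α a * minus α s = coeff α (α s a) := by
  rw [plus_coeff, mul_assoc, plus_minus, ← map_mul, ← map_mul, mul_one]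

/-- The elements `s₋ φ(a) s₊`. -/
def mid (s : M) (a : A) : FractionalSkewMonoidRing α := minus α s * coeff α a * plus α s

theorem mid_expand (u s : M) (a : A) : mid α s a = mid α (u * s) (α u a) := by
  rw [mid, mid, minus_mul, map_mul, ← plus_coeff_minus]
  calc minus α s * coeff α a * plus α s
      = minus α s * (minus α u * plus α u) * coeff α a * (minus α u * plus α u) * plus α s := by
        rw [minus_plus, mul_one, mul_one]
    _ = _ := by simp only [mul_assoc]

theorem mid_add (s : M) (a b : A) : mid α s a + mid α s b = mid α s (a + b) := by
  simp only [mid, map_add, mul_add, add_mul]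

theorem mid_neg (s : M) (a : A) : - mid α s a = mid α s (-a) := by
  simp only [mid, map_neg, mul_neg, neg_mul]

theorem mid_mul (s : M) (a b : A) : mid α s a * mid α s b = mid α s (a * α s 1 * b) := by
  simp only [mid, map_mul, ← plus_minus, mul_assoc]

theorem mid_one (a : A) : mid α (1 : M) a = coeff α a := by
  rw [mid, minus_one, map_one, one_mul, mul_one]

variable [LeftDenominatorMonoid M]

/-- The unital subring `M₋ A M₊ = {s₋ φ(a) s₊ | s ∈ M, a ∈ A}` of `Mᵒᵖ *_α A *_α M`. -/
def middle : Subring (FractionalSkewMonoidRing α) where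
  carrier := {x | ∃ (s : M) (a : A), x = minus α s * coeff α a * plus α s}
  one_mem' := ⟨1, 1, by rw [minus_one, map_one, map_one, mul_one, mul_one]⟩
  zero_mem' := ⟨1, 0, by rw [map_zero, mul_zero, zero_mul]⟩
  neg_mem' := by
    rintro _ ⟨s, a, rfl⟩
    exact ⟨s, -a, mid_neg α s a⟩
  add_mem' := by
    rintro _ _ ⟨s, a, rfl⟩ ⟨t, b, rfl⟩
    obtain ⟨s', t', h⟩ := LeftDenominatorMonoid.ore s t
    have h1 := mid_expand α t' s a
    have h2 := mid_expand α s' t b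
    rw [h] at h2
    refine ⟨t' * s, α t' a + α s' b, ?_⟩
    change mid α s a + mid α t b = mid α _ _
    rw [h1, h2, mid_add]
  mul_mem' := by
    rintro _ _ ⟨s, a, rfl⟩ ⟨t, b, rfl⟩
    obtain ⟨s', t', h⟩ := LeftDenominatorMonoid.ore s t
    have h1 := mid_expand α t' s a
    have h2 := mid_expand α s' t b
    rw [h] at h2
    refine ⟨t' * s, α t' a * α (t' * s) 1 * α s' b, ?_⟩
    change mid α s a * mid α t b = mid α _ _
    rw [h1, h2, mid_mul]

/-- `φ`, viewed as a map from `A` to `M₋ A M₊`. -/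
def toMiddle : A →+* middle α :=
  (coeff α).codRestrict (middle α) fun a => ⟨1, a, (mid_one α a).symm⟩

theorem conj_mem_middle (s : M) {x : FractionalSkewMonoidRing α} (hx : x ∈ middle α) :
    plus α s * x * minus α s ∈ middle α := by
  obtain ⟨t, a, rfl⟩ := hx
  obtain ⟨s', t', h⟩ := LeftDenominatorMonoid.ore s t
  refine ⟨t', α s' (α t 1 * a * α t 1), ?_⟩
  have h1 : plus α s = minus α t' * (plus α s' * plus α t) := by
    rw [← map_mul, h, map_mul, ← mul_assoc, minus_plus, one_mul]
  have h2 : minus α s = minus α t * minus α s' * plus α t' := by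
    rw [← minus_mul, h, minus_mul, mul_assoc, minus_plus, mul_one]
  rw [← plus_coeff_minus, map_mul, map_mul, ← plus_minus, h1, h2]
  simp only [mul_assoc]

/-- The endomorphism `ᾱ_s : x ↦ s₊ x s₋` of `M₋ A M₊`. -/
def middleMap (s : M) : middle α →ₙ+* middle α where
  toFun x := ⟨plus α s * x * minus α s, conj_mem_middle α s x.2⟩
  map_mul' x y := by
    apply Subtype.ext
    change plus α s * (x * y) * minus α s =
      plus α s * x * minus α s * (plus α s * y * minus α s)
    calc plus α s * (x * y : FractionalSkewMonoidRing α) * minus α s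
        = plus α s * x * (minus α s * plus α s) * y * minus α s := by
          rw [minus_plus, mul_one]; simp only [mul_assoc]
      _ = _ := by simp only [mul_assoc]
  map_zero' := by
    apply Subtype.ext
    change plus α s * 0 * minus α s = 0
    rw [mul_zero, zero_mul]
  map_add' x y := by
    apply Subtype.ext
    change plus α s * (x + y) * minus α s =
      plus α s * x * minus α s + plus α s * y * minus α s
    rw [mul_add, add_mul]

/-- The action `ᾱ` of `M` on `M₋ A M₊` which extends `α`. -/
def middleAction : M →* (middle α →ₙ+* middle α) where
  toFun := middleMap α
  map_one' := by
    ext x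
    change plus α 1 * x * minus α 1 = x
    rw [map_one, minus_one, one_mul, mul_one]
  map_mul' s t := by
    ext x
    change plus α (s * t) * x * minus α (s * t) =
      plus α s * (plus α t * x * minus α t) * minus α s
    rw [map_mul, minus_mul]
    simp only [mul_assoc]

theorem middleAction_toMiddle (s : M) (a : A) :
    middleAction α s (toMiddle α a) = toMiddle α (α s a) :=
  Subtype.ext (plus_coeff_minus α s a)

end FractionalSkewMonoidRing

/-! ### The ring of fractions `M⁻¹B` of an action -/

namespace ActionLocalization

variable {M B : Type*} [Monoid M] [LeftDenominatorMonoid M] [NonUnitalRing B]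

/-- `(s₁, b₁) ∼ (s₂, b₂)` if and only if there are `t₁, t₂` with `t₁ s₁ = t₂ s₂` and
`β_{t₁}(b₁) = β_{t₂}(b₂)`. -/
@[reducible]
def setoid (β : M →* (B →ₙ+* B)) : Setoid (M × B) where
  r x y := ∃ t₁ t₂ : M, t₁ * x.1 = t₂ * y.1 ∧ β t₁ x.2 = β t₂ y.2
  iseqv :=
    { refl := fun _ => ⟨1, 1, rfl, rfl⟩
      symm := by
        rintro x y ⟨t₁, t₂, h, h'⟩
        exact ⟨t₂, t₁, h.symm, h'.symm⟩
      trans := by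
        rintro x y z ⟨t₁, t₂, h, h'⟩ ⟨u₁, u₂, k, k'⟩
        obtain ⟨v, w, hvw⟩ := LeftDenominatorMonoid.ore t₂ u₁
        refine ⟨w * t₁, v * u₂, ?_, ?_⟩
        · rw [mul_assoc, mul_assoc, h, ← k, ← mul_assoc, ← mul_assoc, hvw]
        · have e1 : β (w * t₂) y.2 = β (v * u₁) y.2 := by rw [hvw]
          rw [map_mul, map_mul] at e1
          change β w (β t₂ y.2) = β v (β u₁ y.2) at e1
          rw [map_mul, map_mul]
          change β w (β t₁ x.2) = β v (β u₂ z.2)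
          rw [h', e1, k'] }

end ActionLocalization

/-- The set `M⁻¹B` of classes `[s, b]`. -/
def ActionLocalization {M B : Type*} [Monoid M] [LeftDenominatorMonoid M] [NonUnitalRing B]
    (β : M →* (B →ₙ+* B)) : Type _ :=
  Quotient (ActionLocalization.setoid β)

namespace ActionLocalization

theorem map_map {M B : Type*} [Monoid M] [NonUnitalRing B] (β : M →* (B →ₙ+* B))
    (s t : M) (b : B) : β s (β t b) = β (s * t) b := by rw [map_mul]; rfl

variable {M B : Type*} [Monoid M] [LeftDenominatorMonoid M] [NonUnitalRing B]
  (β : M →* (B →ₙ+* B))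

/-- The class `[s, b]`. -/
def mk (s : M) (b : B) : ActionLocalization β := Quotient.mk (setoid β) (s, b)

theorem mk_eq_mk_iff {s₁ s₂ : M} {b₁ b₂ : B} :
    mk β s₁ b₁ = mk β s₂ b₂ ↔ ∃ t₁ t₂ : M, t₁ * s₁ = t₂ * s₂ ∧ β t₁ b₁ = β t₂ b₂ :=
  Quotient.eq (r := setoid β)

theorem mk_expand (t s : M) (b : B) : mk β s b = mk β (t * s) (β t b) := by
  rw [mk_eq_mk_iff]
  exact ⟨t, 1, by rw [one_mul], by rw [map_one]; rfl⟩

/-- Two elements of `M⁻¹B` may be brought to a common denominator and then combined by a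
binary operation of `B`. The denominator is chosen; `combine_mk` shows independence. -/
def combineAux (f : B → B → B) (x y : M × B) : ActionLocalization β :=
  mk β ((LeftDenominatorMonoid.ore x.1 y.1).choose * y.1)
    (f (β (LeftDenominatorMonoid.ore x.1 y.1).choose_spec.choose x.2)
      (β (LeftDenominatorMonoid.ore x.1 y.1).choose y.2))

variable {f : B → B → B}

theorem combine_indep (hf : ∀ t a b, β t (f a b) = f (β t a) (β t b))
    {s₁ s₂ t₁ t₂ u₁ u₂ : M} (a b : B) (ht : t₁ * s₁ = t₂ * s₂)
    (hu : u₁ * s₁ = u₂ * s₂) :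
    mk β (t₂ * s₂) (f (β t₁ a) (β t₂ b)) = mk β (u₂ * s₂) (f (β u₁ a) (β u₂ b)) := by
  obtain ⟨v, w, h⟩ := LeftDenominatorMonoid.ore t₁ u₁
  have h2 : v * u₂ * s₂ = w * t₂ * s₂ := by
    rw [mul_assoc, ← hu, mul_assoc, ← ht, ← mul_assoc, ← mul_assoc, h]
  obtain ⟨z, hz⟩ := LeftDenominatorMonoid.reversible _ _ _ h2
  rw [mk_eq_mk_iff]
  refine ⟨z * w, z * v, ?_, ?_⟩
  · rw [mul_assoc, mul_assoc, ← mul_assoc w, ← mul_assoc v, h2]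
  · rw [hf, hf, map_map, map_map, map_map, map_map, mul_assoc z, mul_assoc z, mul_assoc z,
      mul_assoc z, hz, h]

theorem combineAux_expand_left (hf : ∀ t a b, β t (f a b) = f (β t a) (β t b))
    (t : M) (s₁ s₂ : M) (a b : B) :
    combineAux β f (s₁, a) (s₂, b) = combineAux β f (t * s₁, β t a) (s₂, b) := by
  have h1 := (LeftDenominatorMonoid.ore s₁ s₂).choose_spec.choose_spec
  have h2 := (LeftDenominatorMonoid.ore (t * s₁) s₂).choose_spec.choose_spec
  rw [combineAux, combineAux, map_map]
  exact combine_indep β hf a b h1.symm (by rw [mul_assoc]; exact h2.symm)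

theorem combineAux_expand_right (hf : ∀ t a b, β t (f a b) = f (β t a) (β t b))
    (t : M) (s₁ s₂ : M) (a b : B) :
    combineAux β f (s₁, a) (s₂, b) = combineAux β f (s₁, a) (t * s₂, β t b) := by
  have h1 := (LeftDenominatorMonoid.ore s₁ s₂).choose_spec.choose_spec
  have h2 := (LeftDenominatorMonoid.ore s₁ (t * s₂)).choose_spec.choose_spec
  rw [combineAux, combineAux, map_map]
  dsimp only
  refine (combine_indep β hf a b h1.symm (h2.symm.trans (mul_assoc _ _ _).symm)).trans ?_
  exact congrArg (fun r => mk β r _) (mul_assoc _ _ _)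

/-- The operation on `M⁻¹B` induced by an `M`-equivariant binary operation `f` on `B`:
`[s₁, a], [s₂, b] ↦ [t₂ s₂, f (β_{t₁} a) (β_{t₂} b)]` whenever `t₁ s₁ = t₂ s₂`. -/
def combine (f : B → B → B) (hf : ∀ t a b, β t (f a b) = f (β t a) (β t b)) :
    ActionLocalization β → ActionLocalization β → ActionLocalization β :=
  Quotient.lift₂ (s₁ := setoid β) (s₂ := setoid β) (combineAux β f) (by
    rintro ⟨s₁, a⟩ ⟨s₂, b⟩ ⟨s₁', a'⟩ ⟨s₂', b'⟩ ⟨t, t', h, k⟩ ⟨u, u', h', k'⟩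
    dsimp only at h k h' k'
    rw [combineAux_expand_left β hf t, combineAux_expand_right β hf u,
      combineAux_expand_left β hf t' s₁', combineAux_expand_right β hf u' _ s₂', h, k, h', k'])

theorem combine_mk (hf : ∀ t a b, β t (f a b) = f (β t a) (β t b))
    {s₁ s₂ t₁ t₂ : M} (a b : B) (h : t₁ * s₁ = t₂ * s₂) :
    combine β f hf (mk β s₁ a) (mk β s₂ b) = mk β (t₂ * s₂) (f (β t₁ a) (β t₂ b)) :=
  combine_indep β hf a b
    (LeftDenominatorMonoid.ore s₁ s₂).choose_spec.choose_spec.symm h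

theorem combine_mk_same (hf : ∀ t a b, β t (f a b) = f (β t a) (β t b))
    (s : M) (a b : B) :
    combine β f hf (mk β s a) (mk β s b) = mk β s (f a b) := by
  rw [combine_mk β hf a b (rfl : 1 * s = 1 * s), one_mul, map_one]; rfl

/-- Common denominators. -/
theorem exists_common (x y z : ActionLocalization β) :
    ∃ (s : M) (a b c : B), x = mk β s a ∧ y = mk β s b ∧ z = mk β s c := by
  induction x using Quotient.inductionOn with | _ x =>
  induction y using Quotient.inductionOn with | _ y =>
  induction z using Quotient.inductionOn with | _ z =>
  obtain ⟨v, w, h⟩ := LeftDenominatorMonoid.ore x.1 y.1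
  obtain ⟨v', w', h'⟩ := LeftDenominatorMonoid.ore (v * y.1) z.1
  refine ⟨v' * z.1, β (w' * w) x.2, β (w' * v) y.2, β v' z.2, ?_, ?_, mk_expand β _ _ _⟩
  · rw [h', h, ← mul_assoc]; exact mk_expand β _ _ _
  · rw [h', ← mul_assoc]; exact mk_expand β _ _ _

instance : Add (ActionLocalization β) := ⟨combine β (· + ·) fun t a b => map_add (β t) a b⟩
instance : Mul (ActionLocalization β) := ⟨combine β (· * ·) fun t a b => map_mul (β t) a b⟩
instance : Zero (ActionLocalization β) := ⟨mk β 1 0⟩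
instance : Neg (ActionLocalization β) :=
  ⟨Quotient.lift (s := setoid β) (fun x => mk β x.1 (-x.2)) (by
    rintro x y ⟨t, t', h, k⟩
    exact (mk_eq_mk_iff β).2 ⟨t, t', h, by rw [map_neg, map_neg, k]⟩)⟩

/-- `[s₁, a] + [s₂, b] = [t₂ s₂, β_{t₁}(a) + β_{t₂}(b)]` whenever `t₁ s₁ = t₂ s₂`. -/
theorem mk_add_mk {s₁ s₂ t₁ t₂ : M} (a b : B) (h : t₁ * s₁ = t₂ * s₂) :
    mk β s₁ a + mk β s₂ b = mk β (t₂ * s₂) (β t₁ a + β t₂ b) :=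
  combine_mk β (fun t a b => map_add (β t) a b) a b h

/-- `[s₁, a] [s₂, b] = [t₂ s₂, β_{t₁}(a) β_{t₂}(b)]` whenever `t₁ s₁ = t₂ s₂`. -/
theorem mk_mul_mk {s₁ s₂ t₁ t₂ : M} (a b : B) (h : t₁ * s₁ = t₂ * s₂) :
    mk β s₁ a * mk β s₂ b = mk β (t₂ * s₂) (β t₁ a * β t₂ b) :=
  combine_mk β (fun t a b => map_mul (β t) a b) a b h

theorem mk_add_same (s : M) (a b : B) : mk β s a + mk β s b = mk β s (a + b) :=
  combine_mk_same β (fun t a b => map_add (β t) a b) s a b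

theorem mk_mul_same (s : M) (a b : B) : mk β s a * mk β s b = mk β s (a * b) :=
  combine_mk_same β (fun t a b => map_mul (β t) a b) s a b

theorem neg_mk (s : M) (a : B) : - mk β s a = mk β s (-a) := rfl

theorem zero_eq (s : M) : (0 : ActionLocalization β) = mk β s 0 := by
  change mk β 1 0 = mk β s 0
  rw [mk_expand β s 1 0, mul_one, map_zero]

instance : NonUnitalRing (ActionLocalization β) where
  add_assoc x y z := by
    obtain ⟨s, a, b, c, rfl, rfl, rfl⟩ := exists_common β x y z
    simp only [mk_add_same, add_assoc]
  zero_add x := by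
    obtain ⟨s, a, b, c, rfl, -, -⟩ := exists_common β x x x
    rw [zero_eq β s, mk_add_same, zero_add]
  add_zero x := by
    obtain ⟨s, a, b, c, rfl, -, -⟩ := exists_common β x x x
    rw [zero_eq β s, mk_add_same, add_zero]
  add_comm x y := by
    obtain ⟨s, a, b, c, rfl, rfl, -⟩ := exists_common β x y y
    rw [mk_add_same, mk_add_same, add_comm]
  neg_add_cancel x := by
    obtain ⟨s, a, b, c, rfl, -, -⟩ := exists_common β x x x
    rw [neg_mk, mk_add_same, neg_add_cancel, zero_eq β s]
  left_distrib x y z := by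
    obtain ⟨s, a, b, c, rfl, rfl, rfl⟩ := exists_common β x y z
    simp only [mk_add_same, mk_mul_same, mul_add]
  right_distrib x y z := by
    obtain ⟨s, a, b, c, rfl, rfl, rfl⟩ := exists_common β x y z
    simp only [mk_add_same, mk_mul_same, add_mul]
  zero_mul x := by
    obtain ⟨s, a, b, c, rfl, -, -⟩ := exists_common β x x x
    rw [zero_eq β s, mk_mul_same, zero_mul]
  mul_zero x := by
    obtain ⟨s, a, b, c, rfl, -, -⟩ := exists_common β x x x
    rw [zero_eq β s, mk_mul_same, mul_zero]
  mul_assoc x y z := by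
    obtain ⟨s, a, b, c, rfl, rfl, rfl⟩ := exists_common β x y z
    simp only [mk_mul_same, mul_assoc]
  nsmul := nsmulRec
  zsmul := zsmulRec

end ActionLocalization

/-! ### Skew group rings -/

/-- The skew group ring `D *_β G` over a not necessarily unital ring `D`, whose elements are the
finite formal sums `∑ d_g g`. -/
def SkewGroupRing {G D : Type*} [Group G] [NonUnitalRing D] (_β : G →* RingAut D) : Type _ :=
  G →₀ D

namespace SkewGroupRing

variable {G D : Type*} [Group G] [NonUnitalRing D] (β : G →* RingAut D)

instance : AddCommGroup (SkewGroupRing β) := inferInstanceAs (AddCommGroup (G →₀ D))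

/-- The element `d g`. -/
def single (g : G) (d : D) : SkewGroupRing β := (Finsupp.single g d : G →₀ D)

/-- The product determined by `(d g) (d' h) = d β_g(d') gh`. -/
def mulAux (x y : G →₀ D) : G →₀ D :=
  x.sum fun g d => y.sum fun h d' => Finsupp.single (g * h) (d * β g d')

instance : Mul (SkewGroupRing β) := ⟨mulAux β⟩

theorem single_zero (g : G) : single β g 0 = 0 := Finsupp.single_zero g

theorem single_add (g : G) (d d' : D) :
    single β g (d + d') = single β g d + single β g d' := Finsupp.single_add g d d'

theorem single_mul_single (g h : G) (d d' : D) :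
    single β g d * single β h d' = single β (g * h) (d * β g d') := by
  change mulAux β (Finsupp.single g d) (Finsupp.single h d') = Finsupp.single _ _
  rw [mulAux, Finsupp.sum_single_index, Finsupp.sum_single_index]
  · rw [map_zero, mul_zero, Finsupp.single_zero]
  · simp only [zero_mul, Finsupp.single_zero, Finsupp.sum_fun_zero]

theorem add_mulAux (x y z : G →₀ D) : mulAux β (x + y) z = mulAux β x z + mulAux β y z := by
  refine Finsupp.sum_add_index' (fun g => ?_) (fun g d d' => ?_)
  · simp only [zero_mul, Finsupp.single_zero, Finsupp.sum_fun_zero]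
  · simp only [add_mul, Finsupp.single_add, Finsupp.sum_add]

theorem add_mul' (x y z : SkewGroupRing β) : (x + y) * z = x * z + y * z := add_mulAux β x y z

theorem mulAux_add (x y z : G →₀ D) : mulAux β x (y + z) = mulAux β x y + mulAux β x z := by
  rw [mulAux, mulAux, mulAux, ← Finsupp.sum_add]
  refine Finsupp.sum_congr fun g _ => ?_
  refine Finsupp.sum_add_index' (fun h => ?_) (fun h d d' => ?_)
  · rw [map_zero, mul_zero, Finsupp.single_zero]
  · rw [map_add, mul_add, Finsupp.single_add]

theorem mul_add' (x y z : SkewGroupRing β) : x * (y + z) = x * y + x * z := mulAux_add β x y z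

theorem zero_mul' (x : SkewGroupRing β) : 0 * x = 0 := by
  have h := add_mul' β 0 0 x
  rw [add_zero] at h
  exact left_eq_add.mp h

theorem mul_zero' (x : SkewGroupRing β) : x * 0 = 0 := by
  have h := mul_add' β x 0 0
  rw [add_zero] at h
  exact left_eq_add.mp h

theorem induction {P : SkewGroupRing β → Prop} (x : SkewGroupRing β) (h0 : P 0)
    (hadd : ∀ x y, P x → P y → P (x + y)) (hs : ∀ g d, P (single β g d)) : P x :=
  Finsupp.induction_linear (motive := P) x h0 hadd hs

instance : NonUnitalRing (SkewGroupRing β) where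
  left_distrib := mul_add' β
  right_distrib := add_mul' β
  zero_mul := zero_mul' β
  mul_zero := mul_zero' β
  mul_assoc x y z := by
    induction x using induction β with
    | h0 => simp only [zero_mul']
    | hadd x x' hx hx' => simp only [add_mul', hx, hx']
    | hs g d =>
      induction y using induction β with
      | h0 => simp only [zero_mul', mul_zero']
      | hadd y y' hy hy' => simp only [add_mul', mul_add', hy, hy']
      | hs h d' =>
        induction z using induction β with
        | h0 => simp only [mul_zero']
        | hadd z z' hz hz' => simp only [mul_add', hz, hz']
        | hs k d'' =>
          simp only [single_mul_single, mul_assoc, map_mul, RingAut.mul_apply]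

theorem isIdempotentElem_single_one {e : D} (he : IsIdempotentElem e) :
    IsIdempotentElem (single β 1 e) := by
  rw [IsIdempotentElem, single_mul_single, map_one, RingAut.one_apply, he.eq, one_mul]

/-- The corner `e (D *_β G) e` of the skew group ring at an idempotent `e` of `D`. -/
abbrev corner {e : D} (he : IsIdempotentElem e) : Type _ :=
  (isIdempotentElem_single_one β he).Corner

end SkewGroupRing

/-! ### The dilated ring -/

namespace MonoidAction

variable {S A : Type*} [Monoid S] [LeftDenominatorMonoid S] [Ring A] (α : S →* (A →ₙ+* A))

/-- The unital ring `S̃₋ (A/I) S̃₊`. -/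
abbrev Middle : Type _ := FractionalSkewMonoidRing.middle (tildeAction α)

/-- The action `ᾱ` of `S̃` on `S̃₋ (A/I) S̃₊`. -/
def middleAction : EnvelopingGroup.tilde S →* (Middle α →ₙ+* Middle α) :=
  FractionalSkewMonoidRing.middleAction (tildeAction α)

/-- The ring `S̃⁻¹ (S̃₋ (A/I) S̃₊)`. -/
abbrev Dilation : Type _ := ActionLocalization (middleAction α)

/-- The element `[x, b]` of `S̃⁻¹ (S̃₋ (A/I) S̃₊)`. -/
def frac (x : EnvelopingGroup.tilde S) (b : Middle α) : Dilation α :=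
  ActionLocalization.mk (middleAction α) x b

/-- The canonical map `A/I → S̃₋ (A/I) S̃₊ → S̃⁻¹ (S̃₋ (A/I) S̃₊)`. -/
def toDilation : A ⧸ kernelIdeal α →ₙ+* Dilation α where
  toFun a := frac α 1 (FractionalSkewMonoidRing.toMiddle (tildeAction α) a)
  map_zero' := by rw [map_zero]; rfl
  map_add' a b := by
    rw [map_add]; exact (ActionLocalization.mk_add_same (middleAction α) 1 _ _).symm
  map_mul' a b := by
    rw [map_mul]; exact (ActionLocalization.mk_mul_same (middleAction α) 1 _ _).symm

end MonoidAction

end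

/-! Write `ι` for `toDilation α` and `e = ι(1)`. The ring `D` is built so that the endomorphisms by
which `S̃` acts become invertible: the map `[x, b] ↦ [xs, b]` is bijective by the Ore condition and
reversibility, and its inverse is `α̂_s`. Since `G` is the universal group of `S`, this action of
`S` by automorphisms extends to `G`. Equivariance of `ι` gives `α̂_s(e) = ι(α'_s(1)) ≤ e`.

The homomorphism `Φ` comes from the universal property. The elements `ι(a)`, `λ(s)e` and `eλ(s)⁻¹`
of the skew group ring lie in the corner at `e` and satisfy the defining relations (`cornerHom`).
Equivariance of `Φ` is then multiplicativity. For surjectivity (`cornerHom_surjective`), every `g`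
is a fraction `λ(s)⁻¹λ(t)` and every `d ∈ D` is moved into the image of `ι` by some element of `S`.
With one denominator for both, `e(dg)e` is the image of some `s₋ φ(a) t₊`.

Injectivity of `ι` rests on `α'` acting on `A/I` by injective maps. The delicate point is that `φ`
loses nothing on `A/I`. This is seen by applying `cornerHom` to the simpler localization of `A/I`
itself, where the coefficients visibly survive (`coeff_injective`). In particular `e ≠ 0`, because
`1 ∉ I`. -/

/-! ### Universal property and fractions of the enveloping group -/

namespace EnvelopingGroup

variable {S : Type*} [Monoid S] [LeftDenominatorMonoid S]

/-- The universal property of the enveloping group. -/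
theorem exists_lift {H : Type*} [Group H] (f : S →* H) :
    ∃ F : EnvelopingGroup S →* H, ∀ s, F (of S s) = f s := by
  let _ := EnvelopingGroup.oreSet S
  refine ⟨(OreLocalization.universalMulHom f (toUnits.toMonoidHom.comp
    (f.comp (⊤ : Submonoid S).subtype)) fun _ => rfl :
      OreLocalization (⊤ : Submonoid S) S →* H), fun s => ?_⟩
  exact OreLocalization.universalMulHom_commutes _ _ _

/-- Every element of the enveloping group is a left fraction. -/
theorem exists_of_mul_eq (g : EnvelopingGroup S) : ∃ u v : S, of S u * g = of S v := by
  let _ := EnvelopingGroup.oreSet S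
  obtain ⟨r, s, rfl⟩ : ∃ (r : S) (s : (⊤ : Submonoid S)), g = OreLocalization.oreDiv r s := by
    induction g using OreLocalization.ind with
    | _ r s => exact ⟨r, s, rfl⟩
  refine ⟨s, r, ?_⟩
  change OreLocalization.oreDiv (s : S) (1 : (⊤ : Submonoid S)) * OreLocalization.oreDiv r s =
    OreLocalization.oreDiv r (1 : (⊤ : Submonoid S))
  exact OreLocalization.mul_cancel

end EnvelopingGroup

/-! ### The action by automorphisms on the ring of fractions -/

namespace ActionLocalization

variable {M B : Type*} [Monoid M] [LeftDenominatorMonoid M] [NonUnitalRing B]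
  (β : M →* (B →ₙ+* B))

/-- The endomorphism `[x, b] ↦ [xs, b]` of `M⁻¹B`. -/
noncomputable def shift (s : M) : ActionLocalization β →ₙ+* ActionLocalization β where
  toFun := Quotient.lift (s := setoid β) (fun x => mk β (x.1 * s) x.2) (by
    rintro x y ⟨t, t', h, k⟩
    exact (mk_eq_mk_iff β).2 ⟨t, t', by rw [← mul_assoc, h, mul_assoc], k⟩)
  map_zero' := (zero_eq β (1 * s)).symm
  map_add' x y := by
    obtain ⟨u, a, b, -, rfl, rfl, -⟩ := exists_common β x y y
    rw [mk_add_same]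
    exact (mk_add_same β (u * s) a b).symm
  map_mul' x y := by
    obtain ⟨u, a, b, -, rfl, rfl, -⟩ := exists_common β x y y
    rw [mk_mul_same]
    exact (mk_mul_same β (u * s) a b).symm

theorem shift_mk (s x : M) (b : B) : shift β s (mk β x b) = mk β (x * s) b := rfl

theorem exists_mk (d : ActionLocalization β) : ∃ x b, d = mk β x b := by
  obtain ⟨x, b, -, -, h, -⟩ := exists_common β d d d
  exact ⟨x, b, h⟩

/-- Reversibility cancels `s` on the right, up to a left factor that does not change classes; this
gives injectivity. The Ore condition rewrites any denominator as a left multiple of `s`; this gives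
surjectivity. -/
theorem shift_bijective (s : M) : Function.Bijective (shift β s) := by
  constructor
  · intro x y h
    obtain ⟨u, a, b, -, rfl, rfl, -⟩ := exists_common β x y y
    rw [shift_mk, shift_mk, mk_eq_mk_iff] at h
    obtain ⟨t, t', h, k⟩ := h
    rw [← mul_assoc, ← mul_assoc] at h
    obtain ⟨v, hv⟩ := LeftDenominatorMonoid.reversible _ _ _ h
    rw [mk_eq_mk_iff]
    refine ⟨v * t, v * t', by rw [mul_assoc, hv, mul_assoc], ?_⟩
    rw [← map_map, ← map_map, k]
  · intro y
    obtain ⟨x, b, rfl⟩ := exists_mk β y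
    obtain ⟨s', x', h⟩ := LeftDenominatorMonoid.ore x s
    exact ⟨mk β s' (β x' b), by rw [shift_mk, h, ← mk_expand]⟩

/-- The action of `M` on `M⁻¹B` by automorphisms, inverse to the shifts. -/
noncomputable def action : M →* RingAut (ActionLocalization β) where
  toFun s := (RingEquiv.ofBijective (shift β s) (shift_bijective β s)).symm
  map_one' := by
    ext d
    refine (RingEquiv.symm_apply_eq _).2 ?_
    obtain ⟨x, b, rfl⟩ := exists_mk β d
    change mk β x b = mk β (x * 1) b
    rw [mul_one]
  map_mul' s t := by
    ext d
    refine (RingEquiv.symm_apply_eq _).2 ?_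
    -- Shifts reverse products, so their inverses preserve them. It suffices to test on elements
    -- shifted by `s` and then by `t`.
    obtain ⟨d, rfl⟩ := (shift_bijective β t).2 d
    obtain ⟨d, rfl⟩ := (shift_bijective β s).2 d
    rw [RingAut.mul_apply]
    have h : ∀ (u : M) d, (RingEquiv.ofBijective (shift β u) (shift_bijective β u)).symm
      (shift β u d) = d := fun u d => RingEquiv.symm_apply_apply _ d
    rw [h, h]
    obtain ⟨x, b, rfl⟩ := exists_mk β d
    change mk β (x * s * t) b = mk β (x * (s * t)) b
    rw [mul_assoc]

theorem action_shift (s : M) (d : ActionLocalization β) : action β s (shift β s d) = d :=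
  RingEquiv.symm_apply_apply (RingEquiv.ofBijective (shift β s) (shift_bijective β s)) d

theorem action_mk {s s' x x' : M} (b : B) (h : s' * s = x' * x) :
    action β s (mk β x b) = mk β s' (β x' b) := by
  rw [mk_expand β x' x b, ← h, ← shift_mk, action_shift]

theorem action_mk_one (s : M) (b : B) : action β s (mk β 1 b) = mk β 1 (β s b) :=
  action_mk β b (by rw [one_mul, mul_one])

/-- The map `b ↦ [1, b]` is injective for an action by injective endomorphisms. -/
theorem mk_one_injective (hβ : ∀ s, Function.Injective (β s)) :
    Function.Injective (mk β 1) := by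
  intro a b h
  obtain ⟨t, t', h, k⟩ := (mk_eq_mk_iff β).1 h
  simp only [mul_one] at h
  subst h
  exact hβ _ k

/-- The map `b ↦ [1, b]`. -/
noncomputable def ofBase : B →ₙ+* ActionLocalization β where
  toFun := mk β 1
  map_zero' := rfl
  map_add' a b := (mk_add_same β 1 a b).symm
  map_mul' a b := (mk_mul_same β 1 a b).symm

end ActionLocalization

/-! ### The homomorphism into the corner of a skew group ring -/

namespace SkewGroupRing

variable {G L : Type*} [Group G] [NonUnitalRing L] (γ : G →* RingAut L) {e : L}

/-- An element that the idempotent fixes on both sides, as an element of the corner. -/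
noncomputable def toCorner (he : IsIdempotentElem e) (g : G) (d : L) (h : e * d = d)
    (h' : d * γ g e = d) : corner γ he :=
  ⟨single γ g d, (Subsemigroup.mem_corner_iff (isIdempotentElem_single_one γ he)).2
    ⟨by rw [single_mul_single, map_one, RingAut.one_apply, one_mul, h],
      by rw [single_mul_single, mul_one, h']⟩⟩

end SkewGroupRing

namespace FractionalSkewMonoidRing

open SkewGroupRing

section Corner

variable {M A G L : Type*} [Monoid M] [Ring A] [Group G] [NonUnitalRing L]
  {α : M →* (A →ₙ+* A)} {l : M →* G} {γ : G →* RingAut L} {j : A →ₙ+* L}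

theorem inv_apply_of_equivariant (hj : ∀ s a, γ (l s) (j a) = j (α s a)) (s : M) (a : A) :
    γ (l s)⁻¹ (j (α s a)) = j a := by
  rw [← hj, ← RingAut.mul_apply, ← map_mul, inv_mul_cancel, map_one, RingAut.one_apply]

/-- With `e = j 1`, this is `γ_s(e) ≤ e` transported by the inverse automorphism. It is what places
`e λ(s)⁻¹` in the corner. -/
theorem one_mul_inv_apply_one (hj : ∀ s a, γ (l s) (j a) = j (α s a)) (s : M) :
    j 1 * γ (l s)⁻¹ (j 1) = j 1 := by
  rw [← (γ (l s)).injective.eq_iff, map_mul, ← RingAut.mul_apply, ← map_mul, mul_inv_cancel,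
    map_one γ, RingAut.one_apply, hj, ← map_mul, mul_one]

/-- The images of the generators in the corner of the skew group ring. -/
noncomputable def cornerGenerator (hj : ∀ s a, γ (l s) (j a) = j (α s a)) (he : IsIdempotentElem (j 1)) :
    Generator M A → corner γ he
  | .coeff a => toCorner γ he 1 (j a) (by rw [← map_mul, one_mul])
      (by rw [map_one, RingAut.one_apply, ← map_mul, mul_one])
  | .minus s => toCorner γ he (l s)⁻¹ (j 1) (by rw [← map_mul, one_mul])
      (one_mul_inv_apply_one hj s)
  -- By `hj` the coefficient is `γ_s(e)`, so this is `λ(s)e` with its coefficient moved to the left.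
  | .plus s => toCorner γ he (l s) (j (α s 1)) (by rw [← map_mul, one_mul])
      (by rw [hj, ← map_mul, ← map_mul, mul_one])

/-- The homomorphism from the fractional skew monoid ring to the corner of a skew group ring
that is determined by an equivariant homomorphism of the coefficient rings. -/
noncomputable def cornerHom (hj : ∀ s a, γ (l s) (j a) = j (α s a))
    (he : IsIdempotentElem (j 1)) : FractionalSkewMonoidRing α →+* corner γ he :=
  RingQuot.lift ⟨(FreeAlgebra.lift ℤ (cornerGenerator hj he)).toRingHom, by
    -- The inverse automorphism need not preserve the range of `j`. The relations `coeff_minus` and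
    -- `minus_plus` need it only on values of `j ∘ α s`; `minus_mul` uses `one_mul_inv_apply_one`
    -- instead.
    have key : ∀ s a, γ (l s)⁻¹ (j (α s a)) = j a := inv_apply_of_equivariant hj
    intro x y h
    cases h <;>
      simp only [AlgHom.toRingHom_eq_coe, RingHom.coe_coe, map_mul, map_add, map_one,
        FreeAlgebra.lift_ι_apply] <;> apply Subtype.ext
    case coeff_add a b =>
      change single γ 1 (j (a + b)) = single γ 1 (j a) + single γ 1 (j b)
      rw [map_add, single_add]
    case coeff_mul a b =>
      change single γ 1 (j (a * b)) = single γ 1 (j a) * single γ 1 (j b)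
      rw [single_mul_single, map_one, RingAut.one_apply, one_mul, map_mul]
    case coeff_one => rfl
    case minus_one =>
      change single γ (l 1)⁻¹ (j 1) = single γ 1 (j 1)
      rw [map_one, inv_one]
    case minus_mul s t =>
      change single γ (l (s * t))⁻¹ (j 1) = single γ (l t)⁻¹ (j 1) * single γ (l s)⁻¹ (j 1)
      rw [single_mul_single, map_mul, mul_inv_rev, one_mul_inv_apply_one hj]
    case plus_one =>
      change single γ (l 1) (j (α 1 1)) = single γ 1 (j 1)
      rw [map_one l, map_one α]; rfl
    case plus_mul s t =>
      change single γ (l (s * t)) (j (α (s * t) 1)) =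
        single γ (l s) (j (α s 1)) * single γ (l t) (j (α t 1))
      rw [single_mul_single, hj, ← map_mul l, ← map_mul j, ← map_mul (α s), one_mul, map_mul α]; rfl
    case plus_coeff t a =>
      change single γ (l t) (j (α t 1)) * single γ 1 (j a) =
        single γ 1 (j (α t a)) * single γ (l t) (j (α t 1))
      rw [single_mul_single, single_mul_single, hj, map_one γ, RingAut.one_apply,
        ← map_mul, ← map_mul, ← map_mul, ← map_mul, one_mul, mul_one, mul_one, one_mul]
    case coeff_minus s a =>
      change single γ 1 (j a) * single γ (l s)⁻¹ (j 1) =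
        single γ (l s)⁻¹ (j 1) * single γ 1 (j (α s a))
      rw [single_mul_single, single_mul_single, key, map_one, RingAut.one_apply,
        ← map_mul, ← map_mul, one_mul, mul_one, one_mul, mul_one]
    case minus_plus s =>
      change single γ (l s)⁻¹ (j 1) * single γ (l s) (j (α s 1)) = single γ 1 (j 1)
      rw [single_mul_single, key, inv_mul_cancel, ← map_mul, one_mul]
    case plus_minus s =>
      change single γ (l s) (j (α s 1)) * single γ (l s)⁻¹ (j 1) = single γ 1 (j (α s 1))
      rw [single_mul_single, hj, mul_inv_cancel, ← map_mul, ← map_mul, one_mul]⟩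

variable (hj : ∀ s a, γ (l s) (j a) = j (α s a)) (he : IsIdempotentElem (j 1))

theorem cornerHom_proj (x : Generator M A) :
    cornerHom hj he (proj α (FreeAlgebra.ι ℤ x)) = cornerGenerator hj he x := by
  refine (RingQuot.lift_mkRingHom_apply _ _ _).trans ?_
  exact FreeAlgebra.lift_ι_apply _ _

theorem cornerHom_coeff (a : A) : (cornerHom hj he (coeff α a)).1 = single γ 1 (j a) :=
  congrArg Subtype.val (cornerHom_proj hj he (.coeff a))

theorem cornerHom_minus (s : M) :
    (cornerHom hj he (minus α s)).1 = single γ (l s)⁻¹ (j 1) :=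
  congrArg Subtype.val (cornerHom_proj hj he (.minus s))

theorem cornerHom_plus (s : M) :
    (cornerHom hj he (plus α s)).1 = single γ (l s) (γ (l s) (j 1)) := by
  rw [hj]
  exact congrArg Subtype.val (cornerHom_proj hj he (.plus s))

/-- The Ore condition provides a single element that both clears the denominator of `g` and moves
`d` into the range of `j`. The monomial `dg`, compressed by `e = j 1`, is then the image of one
product `s₋ φ(a) t₊`. -/
theorem cornerHom_surjective (hl : ∀ g, ∃ u v, l u * g = l v)
    (hd : ∀ d, ∃ u a, γ (l u) d = j a)
    (ore : ∀ s t : M, ∃ s' t' : M, s' * t = t' * s) :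
    Function.Surjective (cornerHom hj he) := by
  -- Stating the claim for the compression `exe` of an arbitrary `x` makes it additive, so that
  -- monomials suffice.
  have main : ∀ x : SkewGroupRing γ, ∃ r, (cornerHom hj he r).1 =
      single γ 1 (j 1) * x * single γ 1 (j 1) := by
    intro x
    induction x using SkewGroupRing.induction γ with
    | h0 => exact ⟨0, by rw [map_zero, mul_zero, zero_mul]; rfl⟩
    | hadd x y hx hy =>
      obtain ⟨r, hr⟩ := hx
      obtain ⟨r', hr'⟩ := hy
      refine ⟨r + r', ?_⟩
      rw [map_add, mul_add, add_mul, ← hr, ← hr']; rfl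
    | hs g d =>
      obtain ⟨s, t, hst⟩ := hl g
      obtain ⟨y, b, hb⟩ := hd d
      -- The common left multiple `q * s = p * y` serves as denominator for `g` and for `d`.
      obtain ⟨q, p, hpq⟩ := ore y s
      have hg : g = (l (q * s))⁻¹ * l (q * t) := by
        rw [eq_inv_mul_iff_mul_eq, map_mul, map_mul, mul_assoc, hst]
      have hd' : d = γ (l (q * s))⁻¹ (j (α p b)) := by
        rw [← hj, ← hb, hpq, map_mul, ← RingAut.mul_apply, ← RingAut.mul_apply, ← map_mul,
          ← map_mul, mul_assoc, inv_mul_cancel, map_one, RingAut.one_apply]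
      refine ⟨minus α (q * s) * coeff α (α p b) * plus α (q * t), ?_⟩
      rw [map_mul, map_mul]
      change (cornerHom hj he _).1 * (cornerHom hj he _).1 * (cornerHom hj he _).1 = _
      rw [cornerHom_minus, cornerHom_coeff, cornerHom_plus]
      simp only [single_mul_single, map_one, RingAut.one_apply, one_mul, mul_one]
      -- Both sides are now `e d γ_g(e)` at `g`: the generator `(q * s)₋` supplies the left `e` and
      -- `(q * t)₊` the factor `γ_g(e)`.
      rw [← hg, ← hd', ← RingAut.mul_apply, ← map_mul, ← hg]
  rintro ⟨_, x, rfl⟩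
  obtain ⟨r, hr⟩ := main x
  exact ⟨r, Subtype.ext hr⟩

end Corner

/-! ### Injectivity of the coefficient map and of the action on the middle ring -/

/-- The coefficient map is injective for an action by injective endomorphisms. -/
theorem coeff_injective {S A : Type*} [Monoid S] [LeftDenominatorMonoid S] [Ring A]
    (α : S →* (A →ₙ+* A)) (hα : ∀ s, Function.Injective (α s)) :
    Function.Injective (coeff α) := by
  -- The fractional skew monoid ring is represented in a corner over `S⁻¹A`, whose construction does
  -- not involve that ring. There `φ(a)` becomes `[1, a]` at the group identity, which determines
  -- `a`.
  obtain ⟨γ, hγ⟩ := EnvelopingGroup.exists_lift (ActionLocalization.action α)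
  have hj : ∀ s a, γ (EnvelopingGroup.of S s) (ActionLocalization.ofBase α a) =
      ActionLocalization.ofBase α (α s a) := fun s a => by
    rw [hγ]; exact ActionLocalization.action_mk_one α s a
  have he : IsIdempotentElem (ActionLocalization.ofBase α 1) := by
    rw [IsIdempotentElem, ← map_mul, one_mul]
  intro a b h
  have h1 := cornerHom_coeff hj he a
  rw [h, cornerHom_coeff] at h1
  exact ActionLocalization.mk_one_injective α hα (Finsupp.single_injective _ h1).symm

variable {M A : Type*} [Monoid M] [Ring A] (α : M →* (A →ₙ+* A)) [LeftDenominatorMonoid M]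

/-- Because `s₋ s₊ = 1`, the map `z ↦ s₋ z s₊` undoes `x ↦ s₊ x s₋`. -/
theorem middleAction_injective (s : M) : Function.Injective (middleAction α s) := by
  intro x y h
  have h' : plus α s * x.1 * minus α s = plus α s * y.1 * minus α s := congrArg Subtype.val h
  have key : ∀ z, minus α s * (plus α s * z * minus α s) * plus α s = z := fun z => by
    rw [mul_assoc (plus α s), ← mul_assoc, minus_plus, one_mul, mul_assoc, minus_plus, mul_one]
  exact Subtype.ext (by rw [← key x.1, h', key])

/-- Every element of `M₋ A M₊` is moved into `φ(A)` by the action. -/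
theorem exists_middleAction_eq (x : middle α) : ∃ s a, middleAction α s x = toMiddle α a := by
  obtain ⟨_, s, a, rfl⟩ := x
  -- In `s₊ (s₋ φ(a) s₊) s₋` each outer pair `s₊ s₋` equals `φ(α_s(1))`.
  refine ⟨s, α s 1 * a * α s 1, Subtype.ext ?_⟩
  change plus α s * (minus α s * coeff α a * plus α s) * minus α s = coeff α _
  rw [map_mul, map_mul, ← plus_minus]
  simp only [mul_assoc]

end FractionalSkewMonoidRing

/-! ### The dilation of `A/I` and the main theorem -/

namespace MonoidAction

open EnvelopingGroup FractionalSkewMonoidRing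

variable {S A : Type*} [Monoid S] [LeftDenominatorMonoid S] [Ring A] (α : S →* (A →ₙ+* A))

theorem tildeAction_toTilde_eq (s : S) : tildeAction α (toTilde S s) = quotientAction α s :=
  quotientAction_eq_of_tilde_eq α (toTilde_surjective S _).choose_spec

/-- The map is `φ` followed by `b ↦ [1, b]`. The second is injective because `S̃` acts injectively
on the middle ring, the first because it acts injectively on `A/I`. -/
theorem toDilation_injective : Function.Injective (toDilation α) := by
  intro a b h
  have h' := ActionLocalization.mk_one_injective (middleAction α)
    (FractionalSkewMonoidRing.middleAction_injective (tildeAction α)) h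
  exact coeff_injective (tildeAction α) (fun x => quotientAction_injective α _)
    (congrArg Subtype.val h')

end MonoidAction

open EnvelopingGroup MonoidAction in
theorem theorem5p3 {S A : Type*} [Monoid S] [LeftDenominatorMonoid S] [Ring A]
    (α : S →* (A →ₙ+* A)) (hα : kernelIdeal α ≠ ⊤) :
    ∃ αhat : EnvelopingGroup S →* RingAut (Dilation α),
      Function.Injective (toDilation α) ∧
      (∀ (s : S) (a : A ⧸ kernelIdeal α),
        αhat (of S s) (toDilation α a) = toDilation α (quotientAction α s a)) ∧
      (∀ (s : S) (x x' s' : tilde S) (b : Middle α), s' * toTilde S s = x' * x →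
        αhat (of S s) (frac α x b) = frac α s' (middleAction α x' b)) ∧
      ∃ (e : Dilation α) (he : IsIdempotentElem e),
        e ≠ 0 ∧
        (∀ s : S, αhat (of S s) e * e = αhat (of S s) e ∧
          e * αhat (of S s) e = αhat (of S s) e) ∧
        ∃ Φ : FractionalSkewMonoidRing α →+* SkewGroupRing.corner αhat he,
          Function.Surjective Φ ∧
          (∀ (s : S) (r : FractionalSkewMonoidRing α),
            (Φ (FractionalSkewMonoidRing.plus α s * r * FractionalSkewMonoidRing.minus α s)).1 =
              SkewGroupRing.single αhat (of S s) (αhat (of S s) e) * (Φ r).1 *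
                SkewGroupRing.single αhat (of S s)⁻¹ e) ∧
          (∀ a : A, (Φ (FractionalSkewMonoidRing.coeff α a)).1 =
            SkewGroupRing.single αhat 1 (toDilation α (Ideal.Quotient.mk (kernelIdeal α) a))) ∧
          (∀ s : S, (Φ (FractionalSkewMonoidRing.plus α s)).1 =
            SkewGroupRing.single αhat (of S s) (αhat (of S s) e)) ∧
          (∀ s : S, (Φ (FractionalSkewMonoidRing.minus α s)).1 =
            SkewGroupRing.single αhat (of S s)⁻¹ e) := by
  obtain ⟨αhat, hαhat⟩ := exists_lift
    ((ActionLocalization.action (middleAction α)).comp (toTilde S))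
  have hfrac : ∀ (s : S) (x x' s' : tilde S) (b : Middle α), s' * toTilde S s = x' * x →
      αhat (of S s) (frac α x b) = frac α s' (middleAction α x' b) := by
    intro s x x' s' b h
    rw [hαhat]
    exact ActionLocalization.action_mk (middleAction α) b h
  have hdil : ∀ (s : S) (a : A ⧸ kernelIdeal α),
      αhat (of S s) (toDilation α a) = toDilation α (quotientAction α s a) := by
    intro s a
    refine (hfrac s 1 (toTilde S s) 1 _ (by rw [one_mul, mul_one])).trans ?_
    rw [← tildeAction_toTilde_eq]
    exact congrArg (frac α 1) (FractionalSkewMonoidRing.middleAction_toMiddle _ _ _)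
  -- Composing with `A → A/I` gives a map equivariant for `S` itself, so `cornerHom` applies
  -- directly to the ring built from `α`, with `e = j 1`.
  let j : A →ₙ+* Dilation α :=
    (toDilation α).comp (Ideal.Quotient.mk (kernelIdeal α) : A →ₙ+* A ⧸ kernelIdeal α)
  have hj : ∀ s a, αhat (of S s) (j a) = j (α s a) := fun s a => hdil s _
  have he : IsIdempotentElem (j 1) := by rw [IsIdempotentElem, ← map_mul, one_mul]
  refine ⟨αhat, toDilation_injective α, hdil, hfrac, j 1, he, ?_, ?_,
    FractionalSkewMonoidRing.cornerHom hj he, ?_, ?_,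
    FractionalSkewMonoidRing.cornerHom_coeff hj he, FractionalSkewMonoidRing.cornerHom_plus hj he,
    FractionalSkewMonoidRing.cornerHom_minus hj he⟩
  · intro h
    -- If `e = 0`, injectivity of `ι` forces `1 ∈ I`, hence `I = A`.
    have h1 := toDilation_injective α (h.trans (map_zero (toDilation α)).symm)
    exact hα ((Ideal.eq_top_iff_one _).2 (Ideal.Quotient.eq_zero_iff_mem.1 h1))
  · intro s
    rw [hj, ← map_mul, ← map_mul, one_mul, mul_one]
    exact ⟨rfl, rfl⟩
  · refine FractionalSkewMonoidRing.cornerHom_surjective hj he exists_of_mul_eq ?_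
      LeftDenominatorMonoid.ore
    intro d
    obtain ⟨x, b, rfl⟩ := ActionLocalization.exists_mk _ d
    obtain ⟨s, a, h⟩ := FractionalSkewMonoidRing.exists_middleAction_eq (tildeAction α) b
    -- Here `s` moves `b` into `φ(A/I)`. Acting by a lift of `s * x` instead of `s` also removes the
    -- denominator `x`, since `1 * (s * x) = s * x`.
    obtain ⟨u, hu⟩ := toTilde_surjective S (s * x)
    obtain ⟨a, rfl⟩ := Ideal.Quotient.mk_surjective a
    refine ⟨u, a, (hfrac u x s 1 b (by rw [hu, one_mul])).trans ?_⟩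
    exact congrArg (frac α 1) h
  · intro s r
    rw [map_mul, map_mul, ← FractionalSkewMonoidRing.cornerHom_plus hj he,
      ← FractionalSkewMonoidRing.cornerHom_minus hj he]
    rfl
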